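/- Let $\mathcal P=\{p,q\}$ be the set of primitive programs and $\mathcal B=\{b,c\}$ the set of primitive tests (four distinct symbols). **Strings.** A literal is a primitive test $x$ or its negation $\bar x$; its base is $x$. A test is a nonempty set of literals with distinct bases; $\mathrm{base}(t)$ is the set of bases of its literals, and a primitive program has base $\emptyset$. A *mixed string* is a finite (possibly empty) sequence $a_1\dots a_n$ of alternating tests and primitive programs in which every test $a_i$ with $1<i<n$ has $\mathrm{base}(a_i)=\mathcal B$; $\epsilon$ is the empty one. Concatenation $\sigma\cdot\tau$ is partial: $\epsilon$ is neutral; for nonempty strings $a_1\dots a_n$ and $b_1\dots b_m$ it is $a_1\dots a_nb_1\dots b_m$ if exactly one of $a_n,b_1$ is a program, and $a_1\dots a_{n-1}(a_n\cup b_1)b_2\dots b_m$ if $a_n,b_1$ are tests with disjoint bases, provided that the result is a mixed string; otherwise it is undefined. For $A,A'\subseteq\mathcal B$: $\epsilon$ has type $A\to A$ for every $A$; a one-test string $t$ has type $\mathrm{base}(t)\cup A\to A$ for every $A$ disjoint from $\mathrm{base}(t)$; a one-program string has type $\emptyset\to\mathcal B$; and $a_1\dots a_n$ with $n>1$ has type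 $\mathrm{base}(a_1)\to\mathcal B\setminus\mathrm{base}(a_n)$. A *mixed language* is a set of mixed strings; it has type $A\to A'$ if all its members do. Let $K\cdot L$ be the set of all defined $\sigma\cdot\tau$ with $\sigma\in K$, $\tau\in L$; $L^0=\{\epsilon\}$ and $L^{n+1}=L\cdot L^n$. **Expressions.** Mixed expressions are $e::=0\mid1\mid r\mid l\mid e_1+e_2\mid e_1e_2\mid e^*$ with $r\in\mathcal P$ and $l$ a literal. Their languages are $M(0)=\emptyset$, $M(1)=\{\epsilon\}$, $M(r)=\{r\}$, $M(l)=\{\{l\}\}$, $M(e_1+e_2)=M(e_1)\cup M(e_2)$, $M(e_1e_2)=M(e_1)\cdot M(e_2)$, $M(e^*)=\bigcup_{n\ge0}M(e)^n$. Types are derived by: $\vdash0:A\to A'$; $\vdash1:A\to A$; $\vdash r:\emptyset\to\mathcal B$; $\vdash l:A\cup\{\mathrm{base}(l)\}\to A\setminus\{\mathrm{base}(l)\}$; sums of expressions of the same type $A\to A'$ have that type; $e_1:A\to A'$ and $e_2:A'\to A''$ give $e_1e_2:A\to A''$; and $e:A\to A$ gives $e^*:A\to A$. **Automata.** A *mixed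 automaton* consists of sets $S_A$ ($A\subseteq\mathcal B$), an output map $o:S_\emptyset\to\{0,1\}$, and transitions $\delta_\emptyset:S_\emptyset\times\mathcal P\to S_{\mathcal B}$ and, for $A\ne\emptyset$ and $l$ with $\mathrm{base}(l)\in A$, $\delta_A(\cdot,l):S_A\to S_{A\setminus\{\mathrm{base}(l)\}}$, such that for a test $t$ with base $A$ reading the literals of $t$ from $s\in S_A$ in any two orders leads to the same state. $\mathcal L$ is the mixed automaton whose states over $A$ are the mixed languages of type $A\to\emptyset$, with $o(L)=1$ iff $\epsilon\in L$, $\delta_\emptyset(L,r)=\{\sigma: r\cdot\sigma\in L\}$ and $\delta_A(L,l)=\{\sigma:\{l\}\cdot\sigma\in L\}$. Given an ordering $b_1,\dots,b_n$ of $\mathcal B$, put $A_i=\{b_1,\dots,b_i\}$. A *pseudo-bisimulation* on a mixed automaton relative to this ordering is a family of relations $R_i\subseteq S_{A_i}\times S_{A_i}$ ($0\le i\le n$) such that $s\mathrel{R_0}s'$ implies $o(s)=o(s')$ and $\delta_\emptyset(s,r)\mathrel{R_n}\delta_\emptyset(s',r)$ for all $r\in\mathcal P$, and, for $1\le i\le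 n$, $s\mathrel{R_i}s'$ implies $\delta_{A_i}(s,l)\mathrel{R_{i-1}}\delta_{A_i}(s',l)$ for both literals $l$ with base $b_i$. **Statement.** Write $[b]=b+\bar b$ and let $$\alpha=(bp([b]cq)^*\bar c)^*\bar b,\quad \beta=bp([b]cq+b\bar cp)^*\bar c\bar b+\bar b,\quad \alpha'=([b]cq)^*\bar c\,\alpha,\quad \beta'=([b]cq+b\bar cp)^*\bar c\bar b .$$ Take the ordering $b_1=b$, $b_2=c$, so that $A_0=\emptyset$, $A_1=\{b\}$, $A_2=\{b,c\}$, and let $$\begin{aligned}R_2&=\{(M(\alpha'),M(\beta')),\ (M(0),M(0))\},\\ R_1&=\{(M([b]q\alpha'),M([b]q\beta')),\ (M(\alpha),M(\beta)),\ (M(0),M(0))\},\\ R_0&=\{(M(p\alpha'),M(p\beta')),\ (M(q\alpha'),M(q\beta')),\ (M(1),M(1)),\ (M(0),M(0))\}.\end{aligned}$$ Then: 1. for each $i$, every expression $e$ listed in $R_i$ satisfies $\vdash e:A_i\to\emptyset$, and $M(e)$ has type $A_i\to\emptyset$; in particular $\vdash\alpha:\{b\}\to\emptyset$ and $\vdash\beta:\{b\}\to\emptyset$;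 2. $\langle R_0,R_1,R_2\rangle$ is a pseudo-bisimulation on $\mathcal L$ relative to this ordering, and it relates the states $M(\alpha)$ and $M(\beta)$ over $\{b\}$ (through $R_1$); 3. $M(\alpha)=M(\beta)$. -/

import Mathlib

universe u v w

namespace MixedKAT

/-- A literal over a set `B` of primitive tests: a primitive test or its negation. -/
inductive Literal (B : Type v) : Type v
  | pos (b : B) : Literal B
  | neg (b : B) : Literal B
  deriving DecidableEq

/-- The underlying primitive test of a literal. -/
def Literal.base {B : Type v} : Literal B → B
  | .pos b => b
  | .neg b => b

/-- A test is a nonempty set of literals with distinct bases. -/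
def IsTest {B : Type v} (t : Finset (Literal B)) : Prop :=
  t.Nonempty ∧ Set.InjOn Literal.base (t : Set (Literal B))

/-- The set of primitive tests occurring in a set of literals. -/
def testBase {B : Type v} [DecidableEq B] (t : Finset (Literal B)) : Finset B :=
  t.image Literal.base

/-- The elements from which strings are built: primitive programs and (candidate) tests. -/
inductive Elem (P : Type u) (B : Type v) : Type (max u v)
  | prog (p : P) : Elem P B
  | test (t : Finset (Literal B)) : Elem P B

/-- Whether an element is a test (as opposed to a primitive program). -/
def Elem.isTest {P : Type u} {B : Type v} : Elem P B → Bool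
  | .prog _ => false
  | .test _ => true

/-- The base of an element; primitive programs have empty base. -/
def Elem.base {P : Type u} {B : Type v} [DecidableEq B] : Elem P B → Finset B
  | .prog _ => ∅
  | .test t => testBase t

/-- The sequence `a₁ … aₙ` is a mixed string: its tests are tests, programs and tests alternate,
and every test which is neither the first nor the last element is complete. -/
structure IsMixedWord {P : Type u} {B : Type v} [DecidableEq B] [Fintype B]
    (x : List (Elem P B)) : Prop where
  tests : ∀ t, Elem.test t ∈ x → IsTest t
  alternating : x.IsChain (fun a a' => a.isTest ≠ a'.isTest)
  complete : ∀ y z t, x = y ++ Elem.test t :: z → y ≠ [] → z ≠ [] → testBase t = Finset.univ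

/-- Mixed strings over primitive programs `P` and primitive tests `B`. -/
abbrev MixedString (P : Type u) (B : Type v) [DecidableEq B] [Fintype B] : Type (max u v) :=
  {x : List (Elem P B) // IsMixedWord x}

/-- A mixed language is a set of mixed strings. -/
abbrev MixedLang (P : Type u) (B : Type v) [DecidableEq B] [Fintype B] : Type (max u v) :=
  Set (MixedString P B)

/-- The graph of the partial operation of concatenation, on the underlying sequences. -/
inductive ConcatList {P : Type u} {B : Type v} [DecidableEq B] :
    List (Elem P B) → List (Elem P B) → List (Elem P B) → Prop
  | nil_left (y) : ConcatList [] y y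
  | nil_right (x) : ConcatList x [] x
  | juxtapose (x a a' y) : a.isTest ≠ a'.isTest →
      ConcatList (x ++ [a]) (a' :: y) (x ++ a :: a' :: y)
  | merge (x t t' y) : Disjoint (testBase t) (testBase t') →
      ConcatList (x ++ [Elem.test t]) (Elem.test t' :: y) (x ++ Elem.test (t ∪ t') :: y)

/-- `Concat σ τ ρ`: the concatenation `σ · τ` is defined and equal to the mixed string `ρ`. -/
def Concat {P : Type u} {B : Type v} [DecidableEq B] [Fintype B]
    (σ τ ρ : MixedString P B) : Prop :=
  ConcatList σ.1 τ.1 ρ.1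

/-- `σ.HasType A A'`: the mixed string `σ` has type `A → A'`. -/
def MixedString.HasType {P : Type u} {B : Type v} [DecidableEq B] [Fintype B]
    (σ : MixedString P B) (A A' : Finset B) : Prop :=
  match σ.1 with
  | [] => A = A'
  | [Elem.test t] => Disjoint A' (testBase t) ∧ A = testBase t ∪ A'
  | [Elem.prog _] => A = ∅ ∧ A' = Finset.univ
  | a :: a' :: x => A = a.base ∧ A' = Finset.univ \ ((a' :: x).getLast (by simp)).base

/-- The mixed language `L` has type `A → A'`. -/
def MixedLang.HasType {P : Type u} {B : Type v} [DecidableEq B] [Fintype B]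
    (L : MixedLang P B) (A A' : Finset B) : Prop :=
  ∀ σ ∈ L, MixedString.HasType σ A A'

/-- The empty mixed string. -/
def epsString {P : Type u} {B : Type v} [DecidableEq B] [Fintype B] : MixedString P B :=
  ⟨[], by constructor <;> simp⟩

/-- The mixed string consisting of a single primitive program. -/
def progString {P : Type u} {B : Type v} [DecidableEq B] [Fintype B] (p : P) : MixedString P B :=
  ⟨[Elem.prog p], by
    constructor
    · simp
    · simp
    · intro y z t h hy hz
      have := congrArg List.length h
      have h1 := List.length_pos_iff.2 hy
      have h2 := List.length_pos_iff.2 hz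
      simp at this
      omega⟩

/-- The mixed string consisting of the single test `{l}`. -/
def litString {P : Type u} {B : Type v} [DecidableEq B] [Fintype B] (l : Literal B) :
    MixedString P B :=
  ⟨[Elem.test {l}], by
    constructor
    · simp [IsTest]
    · simp
    · intro y z t h hy hz
      have := congrArg List.length h
      have h1 := List.length_pos_iff.2 hy
      have h2 := List.length_pos_iff.2 hz
      simp at this
      omega⟩

/-- Concatenation of mixed languages: all defined concatenations `σ · τ`. -/
def MixedLang.mul {P : Type u} {B : Type v} [DecidableEq B] [Fintype B]
    (K L : MixedLang P B) : MixedLang P B :=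
  {ρ | ∃ σ ∈ K, ∃ τ ∈ L, Concat σ τ ρ}

/-- Powers of a mixed language: `L⁰ = {ε}`, `Lⁿ⁺¹ = L · Lⁿ`. -/
def MixedLang.pow {P : Type u} {B : Type v} [DecidableEq B] [Fintype B]
    (L : MixedLang P B) : ℕ → MixedLang P B
  | 0 => {epsString}
  | n + 1 => MixedLang.mul L (MixedLang.pow L n)

/-- The derivative of a mixed language with respect to a primitive program. -/
def derivProg {P : Type u} {B : Type v} [DecidableEq B] [Fintype B]
    (p : P) (L : MixedLang P B) : MixedLang P B :=
  {σ | ∃ ρ ∈ L, Concat (progString p) σ ρ}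

/-- The derivative of a mixed language with respect to a literal. -/
def derivLit {P : Type u} {B : Type v} [DecidableEq B] [Fintype B]
    (l : Literal B) (L : MixedLang P B) : MixedLang P B :=
  {σ | ∃ ρ ∈ L, Concat (litString l) σ ρ}

/-! ### Mixed automata -/

/-- `LitPath δ s [x₁, …, xₘ] s'`: reading the literals `x₁, …, xₘ` in this order leads from `s`
to `s'`. -/
inductive LitPath {B : Type v} [DecidableEq B] {S : Finset B → Type w}
    (δ : ∀ A : Finset B, S A → ∀ l : Literal B, l.base ∈ A → S (A.erase l.base)) :
    (Σ A, S A) → List (Literal B) → (Σ A, S A) → Prop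
  | nil (s) : LitPath δ s [] s
  | cons (A) (s : S A) (l) (h : l.base ∈ A) (xs) (s') :
      LitPath δ ⟨A.erase l.base, δ A s l h⟩ xs s' → LitPath δ ⟨A, s⟩ (l :: xs) s'

/-- A mixed automaton over `P` and `B`. That `litStep` sends a state over `A` to one over
`A \ {base l}` is part of its type; `pathIndep` says that all orderings of the literals of
a test with base `A` lead from a given state over `A` to the same state. -/
structure MixedAutomaton (P : Type u) (B : Type v) [DecidableEq B] [Fintype B] where
  State : Finset B → Type w
  out : State ∅ → Bool
  progStep : State ∅ → P → State Finset.univ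
  litStep : ∀ A : Finset B, State A → ∀ l : Literal B, l.base ∈ A → State (A.erase l.base)
  pathIndep : ∀ (A : Finset B) (s : State A) (t : Finset (Literal B)),
    IsTest t → testBase t = A →
    ∀ xs ys : List (Literal B), xs.Nodup → xs.toFinset = t → ys.Nodup → ys.toFinset = t →
    ∀ s₁ s₂ : Σ A, State A,
      LitPath litStep ⟨A, s⟩ xs s₁ → LitPath litStep ⟨A, s⟩ ys s₂ → s₁ = s₂

/-- For an ordering `b₁, …, bₙ` of the primitive tests, the set `Aᵢ = {b₁, …, bᵢ}`. -/
def initialSet {B : Type v} [DecidableEq B] (bs : List B) (i : ℕ) : Finset B :=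
  (bs.take i).toFinset

/-- The family `R₀, …, Rₙ` is a pseudo-bisimulation between `M` and `M'` relative to the ordering
`bs = [b₁, …, bₙ]` of the primitive tests. The relation `Rᵢ ⊆ S_{Aᵢ} × S'_{Aᵢ}` is given as the
family `A ↦ R i A`, which is empty for `A ≠ Aᵢ`; the `(i+1)`-st primitive test is `bs[i]`. -/
structure IsPseudoBisimulation {P : Type u} {B : Type v} [DecidableEq B] [Fintype B]
    (bs : List B) (M M' : MixedAutomaton.{u, v, w} P B)
    (R : ℕ → ∀ A : Finset B, M.State A → M'.State A → Prop) : Prop where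
  nodup : bs.Nodup
  exhaustive : ∀ b : B, b ∈ bs
  support : ∀ i A s s', R i A s s' → i ≤ bs.length ∧ A = initialSet bs i
  out_eq : ∀ s s', R 0 ∅ s s' → M.out s = M'.out s'
  prog : ∀ s s', R 0 ∅ s s' →
    ∀ p : P, R bs.length Finset.univ (M.progStep s p) (M'.progStep s' p)
  lit : ∀ (i : ℕ) (hi : i < bs.length) (s : M.State (initialSet bs (i + 1)))
    (s' : M'.State (initialSet bs (i + 1))), R (i + 1) (initialSet bs (i + 1)) s s' →
    ∀ (l : Literal B) (hl : l.base ∈ initialSet bs (i + 1)), l.base = bs[i] →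
      R i ((initialSet bs (i + 1)).erase l.base) (M.litStep _ s l hl) (M'.litStep _ s' l hl)

/-! ### The automaton of mixed languages -/

section LangAutomaton

variable {P : Type u} {B : Type v} [DecidableEq B] [Fintype B]

theorem concatList_singleton {a : Elem P B} {x y : List (Elem P B)} (h : ConcatList [a] x y) :
    (x = [] ∧ y = [a]) ∨
    (∃ a' z, x = a' :: z ∧ a.isTest ≠ a'.isTest ∧ y = a :: a' :: z) ∨
    (∃ t t' z, a = Elem.test t ∧ x = Elem.test t' :: z ∧ Disjoint (testBase t) (testBase t') ∧
      y = Elem.test (t ∪ t') :: z) := by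
  generalize hw : [a] = w at h
  cases h with
  | nil_left => simp at hw
  | nil_right => subst hw; exact Or.inl ⟨rfl, rfl⟩
  | juxtapose u c c' v hc =>
    obtain ⟨rfl, hca⟩ := List.append_eq_singleton_iff.1 hw.symm |>.resolve_right (by simp)
    simp only [List.cons.injEq, and_true] at hca
    subst hca
    exact Or.inr (Or.inl ⟨c', v, rfl, hc, rfl⟩)
  | merge u t t' v hd =>
    obtain ⟨rfl, hca⟩ := List.append_eq_singleton_iff.1 hw.symm |>.resolve_right (by simp)
    simp only [List.cons.injEq, and_true] at hca
    exact Or.inr (Or.inr ⟨t, t', v, hca.symm, rfl, hd, rfl⟩)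

theorem testBase_union {B : Type v} [DecidableEq B] (s t : Finset (Literal B)) :
    testBase (s ∪ t) = testBase s ∪ testBase t := Finset.image_union _ _

theorem testBase_singleton {B : Type v} [DecidableEq B] (l : Literal B) :
    testBase {l} = {l.base} := Finset.image_singleton _ _

theorem isTest_insert {t : Finset (Literal B)} {l : Literal B} (h : IsTest t)
    (hl : l.base ∉ testBase t) : IsTest ({l} ∪ t) := by
  refine ⟨⟨l, by simp⟩, ?_⟩
  intro x hx y hy hxy
  simp only [Finset.coe_union, Finset.coe_singleton, Set.mem_union, Set.mem_singleton_iff,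
    Finset.mem_coe] at hx hy
  rcases hx with rfl | hx <;> rcases hy with rfl | hy
  · rfl
  · exact absurd (hxy ▸ Finset.mem_image_of_mem _ hy) hl
  · exact absurd (hxy ▸ Finset.mem_image_of_mem _ hx) hl
  · exact h.2 hx hy hxy

theorem isMixedWord_replace {s t : Finset (Literal B)} {x : List (Elem P B)}
    (h : IsMixedWord (Elem.test t :: x)) (hs : IsTest s) : IsMixedWord (Elem.test s :: x) := by
  refine ⟨?_, ?_, ?_⟩
  · intro r hr
    rcases List.mem_cons.1 hr with hr | hr
    · cases hr
      exact hs
    · exact h.tests r (List.mem_cons_of_mem _ hr)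
  · have := h.alternating
    cases x with
    | nil => simp
    | cons a x =>
      rw [List.isChain_cons_cons] at this ⊢
      exact this
  · intro y z r hr hy hz
    cases y with
    | nil => exact absurd rfl hy
    | cons a y =>
      rw [List.cons_append, List.cons.injEq] at hr
      exact h.complete (Elem.test t :: y) z r (by rw [hr.2]; rfl) (by simp) hz

theorem derivProg_hasType {L : MixedLang P B} (h : L.HasType ∅ ∅) (p : P) :
    (derivProg p L).HasType Finset.univ ∅ := by
  rintro ⟨x, hx⟩ ⟨⟨y, hy⟩, hyL, hc⟩
  have ht := h _ hyL
  rcases concatList_singleton hc with ⟨h1, h2⟩ | ⟨a', z, h1, h2, h3⟩ | ⟨t, t', z, h1, -⟩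
  · simp only at h1 h2
    subst h1 h2
    simpa [MixedString.HasType] using ht.2.symm
  · simp only at h1 h3
    subst h1 h3
    cases a' with
    | prog q => simp [Elem.isTest] at h2
    | test t =>
      cases z with
      | nil =>
        have h4 : testBase t = Finset.univ := by
          have h5 : (∅ : Finset B) = Finset.univ \ testBase t := ht.2
          exact Finset.univ_subset_iff.1 (Finset.sdiff_eq_empty_iff_subset.1 h5.symm)
        simp [MixedString.HasType, h4]
      | cons c z =>
        have h4 := hy.complete [Elem.prog p] (c :: z) t rfl (by simp) (by simp)
        refine ⟨h4.symm, ?_⟩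
        simpa using ht.2
  · simp at h1

theorem derivLit_hasType {L : MixedLang P B} {A : Finset B} (h : L.HasType A ∅)
    (l : Literal B) : (derivLit l L).HasType (A.erase l.base) ∅ := by
  rintro ⟨x, hx⟩ ⟨⟨y, hy⟩, hyL, hc⟩
  have ht := h _ hyL
  rcases concatList_singleton hc with ⟨h1, h2⟩ | ⟨a', z, h1, h2, h3⟩ | ⟨t, t', z, h1, h2, h3, h4⟩
  · simp only at h1 h2
    subst h1 h2
    have := ht.2
    simp only [testBase_singleton, Finset.union_empty] at this
    simp [MixedString.HasType, this]
  · simp only at h1 h3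
    subst h1 h3
    cases a' with
    | test t => simp [Elem.isTest] at h2
    | prog q =>
      have hA : A = {l.base} := by
        have := ht.1
        simpa [Elem.base, testBase_singleton] using this
      cases z with
      | nil =>
        have h4 : (∅ : Finset B) = Finset.univ := by
          simpa [Elem.base] using ht.2
        exact ⟨by simp [hA], h4⟩
      | cons c z =>
        refine ⟨by simp [hA, Elem.base], ?_⟩
        simpa using ht.2
  · simp only at h2 h4
    subst h2 h4
    simp only [Elem.test.injEq] at h1
    subst h1
    rw [testBase_singleton, Finset.disjoint_singleton_left] at h3
    cases z with
    | nil =>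
      have hA : A = {l.base} ∪ testBase t' := by
        have := ht.2
        rwa [testBase_union, testBase_singleton, Finset.union_empty] at this
      refine ⟨by simp, ?_⟩
      ext b
      simp only [hA, Finset.mem_erase, Finset.mem_union, Finset.mem_singleton,
        Finset.notMem_empty, or_false]
      constructor
      · tauto
      · intro hb
        exact ⟨fun e => h3 (e ▸ hb), Or.inr hb⟩
    | cons c z =>
      have hA : A = {l.base} ∪ testBase t' := by
        have := ht.1
        rwa [Elem.base, testBase_union, testBase_singleton] at this
      refine ⟨?_, ?_⟩
      · ext b
        simp only [hA, Elem.base, Finset.mem_erase, Finset.mem_union, Finset.mem_singleton]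
        constructor
        · tauto
        · intro hb
          exact ⟨fun e => h3 (e ▸ hb), Or.inr hb⟩
      · simpa using ht.2

theorem derivLit_comm_subset (l l' : Literal B) (L : MixedLang P B) :
    derivLit l (derivLit l' L) ⊆ derivLit l' (derivLit l L) := by
  by_cases hll : l = l'
  · subst hll
    exact le_rfl
  rintro ⟨x, hx⟩ ⟨⟨y, hy⟩, ⟨⟨z, hz⟩, hzL, hc'⟩, hc⟩
  simp only [Concat, litString] at hc hc'
  have hl : IsTest ({l} : Finset (Literal B)) := by simp [IsTest]
  have hl' : IsTest ({l'} : Finset (Literal B)) := by simp [IsTest]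
  rcases concatList_singleton hc with
    ⟨rfl, rfl⟩ | ⟨a', w, rfl, h2, rfl⟩ | ⟨t, t', w, h1, rfl, h3, rfl⟩
  · rcases concatList_singleton hc' with ⟨h1, -⟩ | ⟨a', w, h1, h2, -⟩ | ⟨s, s', w, h1, h2, h3, rfl⟩
    · simp at h1
    · simp only [List.cons.injEq] at h1
      rw [← h1.1] at h2
      simp [Elem.isTest] at h2
    · simp only [Elem.test.injEq] at h1
      simp only [List.cons.injEq, Elem.test.injEq] at h2
      obtain ⟨rfl, rfl⟩ := h2
      subst h1
      refine ⟨litString l', ⟨_, hzL, ?_⟩, ConcatList.nil_right _⟩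
      have := ConcatList.merge (P := P) [] _ _ [] h3.symm
      rwa [Finset.union_comm] at this
  · rcases concatList_singleton hc' with
      ⟨h1, -⟩ | ⟨a'', w', h1, h4, -⟩ | ⟨s, s', w', h1, h4, h3, rfl⟩
    · simp at h1
    · simp only [List.cons.injEq] at h1
      rw [← h1.1] at h4
      simp [Elem.isTest] at h4
    · simp only [Elem.test.injEq] at h1
      simp only [List.cons.injEq, Elem.test.injEq] at h4
      obtain ⟨rfl, rfl⟩ := h4
      subst h1
      refine ⟨⟨_, isMixedWord_replace hy hl'⟩, ⟨_, hzL, ?_⟩,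
        ConcatList.juxtapose [] (Elem.test {l'}) a' w h2⟩
      have := ConcatList.merge [] _ _ (a' :: w) h3.symm
      rwa [Finset.union_comm] at this
  · rcases concatList_singleton hc' with
      ⟨h4, -⟩ | ⟨a'', w', h4, h5, -⟩ | ⟨s, s', w', h4, h5, h6, rfl⟩
    · simp at h4
    · simp only [List.cons.injEq] at h4
      rw [← h4.1] at h5
      simp [Elem.isTest] at h5
    · simp only [Elem.test.injEq] at h1 h4
      simp only [List.cons.injEq, Elem.test.injEq] at h5
      obtain ⟨rfl, rfl⟩ := h5
      subst h1 h4
      rw [testBase_union, Finset.disjoint_union_right] at h6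
      have ht' : IsTest t' := hx.tests t' (by simp)
      have hb : l'.base ∉ testBase t' := by
        have := h6.2
        rwa [testBase_singleton, Finset.disjoint_singleton_left] at this
      refine ⟨⟨_, isMixedWord_replace hx (isTest_insert ht' hb)⟩, ⟨_, hzL, ?_⟩,
        ConcatList.merge [] _ _ w h6.2⟩
      have h7 : Disjoint (testBase {l}) (testBase ({l'} ∪ t')) := by
        rw [testBase_union, Finset.disjoint_union_right]
        exact ⟨h6.1.symm, h3⟩
      have := ConcatList.merge (P := P) [] _ _ w h7
      rwa [Finset.union_left_comm] at this

theorem derivLit_comm (l l' : Literal B) (L : MixedLang P B) :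
    derivLit l (derivLit l' L) = derivLit l' (derivLit l L) :=
  Set.Subset.antisymm (derivLit_comm_subset l l' L) (derivLit_comm_subset l' l L)

theorem litPath_lang
    {s s' : Σ A : Finset B, {L : MixedLang P B // L.HasType A ∅}} {xs : List (Literal B)}
    (h : LitPath (fun _ L l _ => ⟨derivLit l L.1, derivLit_hasType L.2 l⟩) s xs s') :
    s'.1 = xs.foldl (fun A l => A.erase l.base) s.1 ∧
      s'.2.1 = xs.foldl (fun L l => derivLit l L) s.2.1 := by
  induction h with
  | nil s => exact ⟨rfl, rfl⟩
  | cons A s l h xs s' _ ih => exact ih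

end LangAutomaton

open Classical in
/-- The automaton whose states over `A` are the mixed languages of type `A → ∅`; a language
is accepting if it contains the empty string, and transitions are derivatives. -/
noncomputable def langAutomaton (P : Type u) (B : Type v) [DecidableEq B] [Fintype B] :
    MixedAutomaton.{u, v, max u v} P B where
  State A := {L : MixedLang P B // L.HasType A ∅}
  out L := decide (epsString ∈ L.1)
  progStep L p := ⟨derivProg p L.1, derivProg_hasType L.2 p⟩
  litStep _ L l _ := ⟨derivLit l L.1, derivLit_hasType L.2 l⟩
  pathIndep := by
    rintro A s t - - xs ys hx hxt hy hyt ⟨A₁, L₁, h₁⟩ ⟨A₂, L₂, h₂⟩ p₁ p₂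
    have hp : xs.Perm ys := List.perm_of_nodup_nodup_toFinset_eq hx hy
      (hxt.trans hyt.symm)
    obtain ⟨e₁, f₁⟩ := litPath_lang p₁
    obtain ⟨e₂, f₂⟩ := litPath_lang p₂
    have e : A₁ = A₂ := by
      refine e₁.trans (Eq.trans ?_ e₂.symm)
      exact hp.foldl_eq' (f := fun (C : Finset B) (l : Literal B) => C.erase l.base)
        (fun x _ y _ z => Finset.erase_right_comm) _
    have f : L₁ = L₂ := by
      refine f₁.trans (Eq.trans ?_ f₂.symm)
      exact hp.foldl_eq' (f := fun (C : MixedLang P B) (l : Literal B) => derivLit l C)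
        (fun x _ y _ z => derivLit_comm _ _ _) _
    subst e f
    rfl

/-! ### Mixed expressions -/

/-- Mixed expressions over `P` and `B`. -/
inductive MixedExpr (P : Type u) (B : Type v) : Type (max u v)
  | zero : MixedExpr P B
  | one : MixedExpr P B
  | prog (p : P) : MixedExpr P B
  | lit (l : Literal B) : MixedExpr P B
  | add (e₁ e₂ : MixedExpr P B) : MixedExpr P B
  | mul (e₁ e₂ : MixedExpr P B) : MixedExpr P B
  | star (e : MixedExpr P B) : MixedExpr P B

instance {P : Type u} {B : Type v} : Zero (MixedExpr P B) := ⟨MixedExpr.zero⟩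
instance {P : Type u} {B : Type v} : One (MixedExpr P B) := ⟨MixedExpr.one⟩
instance {P : Type u} {B : Type v} : Add (MixedExpr P B) := ⟨MixedExpr.add⟩
instance {P : Type u} {B : Type v} : Mul (MixedExpr P B) := ⟨MixedExpr.mul⟩

/-- The mixed language denoted by a mixed expression. -/
def MixedExpr.lang {P : Type u} {B : Type v} [DecidableEq B] [Fintype B] :
    MixedExpr P B → MixedLang P B
  | .zero => ∅
  | .one => {epsString}
  | .prog p => {progString p}
  | .lit l => {litString l}
  | .add e₁ e₂ => e₁.lang ∪ e₂.lang
  | .mul e₁ e₂ => MixedLang.mul e₁.lang e₂.lang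
  | .star e => ⋃ n : ℕ, MixedLang.pow e.lang n

/-- The type judgment `⊢ e : A → A'`. -/
inductive MixedExpr.HasType {P : Type u} {B : Type v} [DecidableEq B] [Fintype B] :
    MixedExpr P B → Finset B → Finset B → Prop
  | zero (A A') : HasType .zero A A'
  | one (A) : HasType .one A A
  | prog (p) : HasType (.prog p) ∅ Finset.univ
  | lit (l) (A) : HasType (.lit l) (A ∪ {l.base}) (A \ {l.base})
  | add {e₁ e₂ A A'} : HasType e₁ A A' → HasType e₂ A A' → HasType (.add e₁ e₂) A A'
  | mul {e₁ e₂ A A' A''} : HasType e₁ A A' → HasType e₂ A' A'' → HasType (.mul e₁ e₂) A A''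
  | star {e A} : HasType e A A → HasType (.star e) A A

/-! ### The two expressions -/

/-- The primitive programs `p`, `q`. -/
inductive Prog : Type
  | p : Prog
  | q : Prog

/-- The primitive tests `b`, `c`. -/
inductive Tst : Type
  | b : Tst
  | c : Tst
  deriving DecidableEq

instance : Fintype Tst := ⟨{.b, .c}, fun x => by cases x <;> simp⟩

namespace Ex

/-- The expression `p`. -/
def p : MixedExpr Prog Tst := .prog .p
/-- The expression `q`. -/
def q : MixedExpr Prog Tst := .prog .q
/-- The expression `b`. -/
def b : MixedExpr Prog Tst := .lit (.pos .b)
/-- The expression `b̄`. -/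
def nb : MixedExpr Prog Tst := .lit (.neg .b)
/-- The expression `c`. -/
def c : MixedExpr Prog Tst := .lit (.pos .c)
/-- The expression `c̄`. -/
def nc : MixedExpr Prog Tst := .lit (.neg .c)

/-- The shorthand `[b] = b + b̄`. -/
def bb : MixedExpr Prog Tst := b + nb

/-- `α = (b p ([b] c q)* c̄)* b̄`. -/
def α : MixedExpr Prog Tst := (b * p * (bb * c * q).star * nc).star * nb

/-- `β = b p ([b] c q + b c̄ p)* c̄ b̄ + b̄`. -/
def β : MixedExpr Prog Tst := b * p * (bb * c * q + b * nc * p).star * nc * nb + nb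

/-- `α' = ([b] c q)* c̄ α`. -/
def α' : MixedExpr Prog Tst := (bb * c * q).star * nc * α

/-- `β' = ([b] c q + b c̄ p)* c̄ b̄`. -/
def β' : MixedExpr Prog Tst := (bb * c * q + b * nc * p).star * nc * nb

/-- The ordering `b₁ = b`, `b₂ = c` of the primitive tests. -/
def order : List Tst := [.b, .c]

/-- The pairs of expressions whose languages make up the relations `R₀`, `R₁`, `R₂`. -/
def pairs : ℕ → Set (MixedExpr Prog Tst × MixedExpr Prog Tst)
  | 0 => {(p * α', p * β'), (q * α', q * β'), (1, 1), (0, 0)}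
  | 1 => {(bb * q * α', bb * q * β'), (α, β), (0, 0)}
  | 2 => {(α', β'), (0, 0)}
  | _ => ∅

/-- The relations `Rᵢ = {(M(e), M(e')) : (e, e') ∈ pairs i}` on the languages of
type `Aᵢ → ∅`. -/
def R (i : ℕ) (A : Finset Tst) (K L : (langAutomaton Prog Tst).State A) : Prop :=
  A = initialSet order i ∧ ∃ e e', (e, e') ∈ pairs i ∧ K.1 = e.lang ∧ L.1 = e'.lang

end Ex

end MixedKAT

namespace MixedKAT

section General

set_option linter.unusedSectionVars false

variable {P : Type u} {B : Type v} [DecidableEq B] [Fintype B]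

/-! ### Reversal and associativity of concatenation -/

/-! The equality of languages is proved by coinduction: a pseudo-bisimulation on the automaton of
languages relates only equal languages (`eq_of_pseudoBisimulation`). A string of type `Aᵢ → ∅` with
`i ≥ 1` has in its first test a literal over `bᵢ`; for `i = 0` it is empty or starts with a program.
Deleting that symbol gives a shorter string, whose membership in the derivative is equivalent to
membership of the original. Since the literals of a test may be read in any order, the one order
fixed in advance suffices.

That the given relations qualify rests on four identities of languages, obtained by unfolding stars
and commuting literals: α = b·pα' + b̄·1, β = b·pβ' + b̄·1, α' = c·[b]qα' + c̄·α, β' = c·[b]qβ' +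
c̄·β. The derivatives can then be read off (`derivLit_mul`, `derivProg_mul`). This needs typing: in
`l·L` no string of `L` may be lost through an undefined concatenation, and the type of `L`
guarantees exactly that. Hence the soundness of typing (`MixedExpr.HasType.lang`) and the
associativity of the partial product (`MixedLang.mul_assoc`). -/

theorem ConcatList.reverse {x y z : List (Elem P B)} (h : ConcatList x y z) :
    ConcatList y.reverse x.reverse z.reverse := by
  cases h with
  | nil_left => exact ConcatList.nil_right _
  | nil_right => exact ConcatList.nil_left _
  | juxtapose x a a' y h =>
    simpa using ConcatList.juxtapose y.reverse a' a x.reverse h.symm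
  | merge x t t' y h =>
    simpa [Finset.union_comm] using ConcatList.merge y.reverse t' t x.reverse h.symm

theorem IsMixedWord.reverse {x : List (Elem P B)} (h : IsMixedWord x) :
    IsMixedWord x.reverse where
  tests t ht := h.tests t (List.mem_reverse.1 ht)
  alternating := by
    rw [List.isChain_reverse]
    exact h.alternating.imp fun _ _ hab => hab.symm
  complete y z t e hy hz :=
    h.complete z.reverse y.reverse t (by simpa using congrArg List.reverse e)
      (by simpa using hz) (by simpa using hy)

/-- Each concatenation acts at one seam. The seams meet only if `y` contributes a single symbol,
which is why every case splits on whether the rest of `y` is empty. -/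
theorem ConcatList.assoc {x y z u w : List (Elem P B)} (h₁ : ConcatList x y u)
    (h₂ : ConcatList u z w) : ∃ v, ConcatList y z v ∧ ConcatList x v w := by
  cases h₁ with
  | nil_left => exact ⟨w, h₂, .nil_left _⟩
  | nil_right => exact ⟨z, .nil_left _, h₂⟩
  | juxtapose x a a' y ha =>
    generalize hu : x ++ a :: a' :: y = u at h₂
    cases h₂ with
    | nil_left => simp at hu
    | nil_right => subst hu; exact ⟨_, .nil_right _, .juxtapose _ _ _ _ ha⟩
    | juxtapose s d d' z hd =>
      rcases List.eq_nil_or_concat' y with rfl | ⟨y, e, rfl⟩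
      · obtain ⟨rfl, h⟩ := List.append_inj' (s₁ := x ++ [a])
          (s₂ := s) (t₂ := [d]) (t₁ := [a']) (by simpa using hu) rfl
        obtain rfl : a' = d := by simpa using h
        exact ⟨_, .juxtapose [] _ _ _ hd, by simpa using ConcatList.juxtapose x a a' (d' :: z) ha⟩
      · obtain ⟨rfl, h⟩ := List.append_inj' (s₁ := x ++ a :: a' :: y)
          (s₂ := s) (t₂ := [d]) (t₁ := [e])
          (by simpa using hu) rfl
        obtain rfl : e = d := by simpa using h
        exact ⟨_, .juxtapose (a' :: y) _ _ _ hd,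
          by simpa using ConcatList.juxtapose x a a' (y ++ e :: d' :: z) ha⟩
    | merge s d d' z hd =>
      rcases List.eq_nil_or_concat' y with rfl | ⟨y, e, rfl⟩
      · obtain ⟨rfl, h⟩ := List.append_inj' (s₁ := x ++ [a])
          (s₂ := s) (t₂ := [.test d]) (t₁ := [a']) (by simpa using hu) rfl
        obtain rfl : a' = Elem.test d := by simpa using h
        exact ⟨_, .merge [] _ _ _ hd,
          by simpa using ConcatList.juxtapose x a (.test (d ∪ d')) z ha⟩
      · obtain ⟨rfl, h⟩ := List.append_inj' (s₁ := x ++ a :: a' :: y)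
          (s₂ := s) (t₂ := [.test d]) (t₁ := [e])
          (by simpa using hu) rfl
        obtain rfl : e = Elem.test d := by simpa using h
        exact ⟨_, .merge (a' :: y) _ _ _ hd,
          by simpa using ConcatList.juxtapose x a a' (y ++ .test (d ∪ d') :: z) ha⟩
  | merge x t t' y ht =>
    generalize hu : x ++ Elem.test (t ∪ t') :: y = u at h₂
    cases h₂ with
    | nil_left => simp at hu
    | nil_right => subst hu; exact ⟨_, .nil_right _, .merge _ _ _ _ ht⟩
    | juxtapose s d d' z hd =>
      rcases List.eq_nil_or_concat' y with rfl | ⟨y, e, rfl⟩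
      · obtain ⟨rfl, h⟩ := List.append_inj' (s₁ := x)
          (s₂ := s) (t₂ := [d]) (t₁ := [Elem.test (t ∪ t')]) hu rfl
        obtain rfl : Elem.test (t ∪ t') = d := by simpa using h
        exact ⟨_, .juxtapose [] (.test t') _ _ hd, .merge _ _ _ _ ht⟩
      · obtain ⟨rfl, h⟩ := List.append_inj' (s₁ := x ++ Elem.test (t ∪ t') :: y)
          (s₂ := s) (t₂ := [d]) (t₁ := [e])
          (by simpa using hu) rfl
        obtain rfl : e = d := by simpa using h
        exact ⟨_, .juxtapose (.test t' :: y) _ _ _ hd,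
          by simpa using ConcatList.merge x t t' (y ++ e :: d' :: z) ht⟩
    | merge s d d' z hd =>
      rcases List.eq_nil_or_concat' y with rfl | ⟨y, e, rfl⟩
      · obtain ⟨rfl, h⟩ := List.append_inj' (s₁ := x)
          (s₂ := s) (t₂ := [.test d]) (t₁ := [Elem.test (t ∪ t')]) hu rfl
        obtain rfl : t ∪ t' = d := by simpa using h
        -- Three tests merge into one: pairwise disjointness of their bases can be regrouped.
        rw [testBase_union, Finset.disjoint_union_left] at hd
        refine ⟨_, .merge [] t' d' z hd.2, ?_⟩
        rw [Finset.union_assoc]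
        refine .merge _ _ _ _ ?_
        rw [testBase_union, Finset.disjoint_union_right]
        exact ⟨ht, hd.1⟩
      · obtain ⟨rfl, h⟩ := List.append_inj' (s₁ := x ++ Elem.test (t ∪ t') :: y)
          (s₂ := s) (t₂ := [.test d]) (t₁ := [e])
          (by simpa using hu) rfl
        obtain rfl : e = Elem.test d := by simpa using h
        exact ⟨_, .merge (.test t' :: y) _ _ _ hd,
          by simpa using ConcatList.merge x t t' (y ++ .test (d ∪ d') :: z) ht⟩

theorem IsMixedWord.of_append {x y : List (Elem P B)} (h : IsMixedWord (x ++ y)) :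
    IsMixedWord y where
  tests t ht := h.tests t (by simp [ht])
  alternating := h.alternating.right_of_append
  complete z w t e hz hw := h.complete (x ++ z) w t (by simp [e]) (by simp [hz]) hw

theorem IsMixedWord.tail {a : Elem P B} {x : List (Elem P B)} (h : IsMixedWord (a :: x)) :
    IsMixedWord x :=
  IsMixedWord.of_append (x := [a]) h

theorem IsTest.mono {s t : Finset (Literal B)} (ht : IsTest t) (hs : s.Nonempty) (h : s ⊆ t) :
    IsTest s :=
  ⟨hs, ht.2.mono (Finset.coe_subset.2 h)⟩

/-- The right factor is a suffix of the result, up to shrinking its first test, and a first test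
need not be complete. Nonemptiness is assumed because merging would hide an empty test. -/
theorem IsMixedWord.of_concat_right {x y z : List (Elem P B)} (h : IsMixedWord z)
    (hc : ConcatList x y z) (hy : ∀ t, Elem.test t ∈ y → t.Nonempty) : IsMixedWord y := by
  cases hc with
  | nil_left => exact h
  | nil_right => exact epsString.2
  | juxtapose x a a' y _ => exact (IsMixedWord.of_append (x := x) h).tail
  | merge x t t' y _ =>
    have h' := IsMixedWord.of_append h
    exact isMixedWord_replace h'
      ((h'.tests (t ∪ t') (by simp)).mono (hy t' (by simp)) Finset.subset_union_right)

theorem ConcatList.nonempty {x y z : List (Elem P B)} (hc : ConcatList x y z)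
    (hx : ∀ t, Elem.test t ∈ x → t.Nonempty) (hy : ∀ t, Elem.test t ∈ y → t.Nonempty) :
    ∀ t, Elem.test t ∈ z → t.Nonempty := by
  cases hc with
  | nil_left => exact hy
  | nil_right => exact hx
  | juxtapose x a a' y _ =>
    simp only [List.mem_append, List.mem_cons, List.not_mem_nil, or_false] at *
    intro t ht
    have := hx t
    have := hy t
    tauto
  | merge x s s' y _ =>
    simp only [List.mem_append, List.mem_cons, List.not_mem_nil, or_false, Elem.test.injEq] at *
    rintro t (ht | rfl | ht)
    · exact hx t (.inl ht)
    · exact (hx s (.inr rfl)).mono Finset.subset_union_left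
    · exact hy t (.inr ht)

/-- Beyond `ConcatList.assoc`, the regrouped intermediate product must itself be a mixed string; it
is one as a right factor of `ω`. -/
theorem Concat.assoc {σ τ ρ υ ω : MixedString P B} (h₁ : Concat σ τ υ) (h₂ : Concat υ ρ ω) :
    ∃ φ, Concat τ ρ φ ∧ Concat σ φ ω := by
  obtain ⟨v, h₃, h₄⟩ := ConcatList.assoc h₁ h₂
  exact ⟨⟨v, ω.2.of_concat_right h₄ (h₃.nonempty (fun t ht => (τ.2.tests t ht).1)
    fun t ht => (ρ.2.tests t ht).1)⟩, h₃, h₄⟩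

/-- The reversal of a mixed string. -/
def MixedString.reverse (σ : MixedString P B) : MixedString P B :=
  ⟨σ.1.reverse, σ.2.reverse⟩

theorem MixedString.reverse_reverse (σ : MixedString P B) : σ.reverse.reverse = σ :=
  Subtype.ext (List.reverse_reverse _)

theorem Concat.reverse {σ τ ρ : MixedString P B} (h : Concat σ τ ρ) :
    Concat τ.reverse σ.reverse ρ.reverse :=
  ConcatList.reverse h

/-- The mirror image of `Concat.assoc`, since reversal swaps the factors. -/
theorem Concat.assoc' {σ τ ρ υ ω : MixedString P B} (h₁ : Concat τ ρ υ) (h₂ : Concat σ υ ω) :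
    ∃ φ, Concat σ τ φ ∧ Concat φ ρ ω := by
  obtain ⟨φ, h₃, h₄⟩ := h₁.reverse.assoc h₂.reverse
  have h₃ := h₃.reverse
  have h₄ := h₄.reverse
  simp only [MixedString.reverse_reverse] at h₃ h₄
  exact ⟨_, h₃, h₄⟩

/-! ### The algebra of mixed languages -/

namespace MixedLang

theorem mul_assoc (K L N : MixedLang P B) : (K.mul L).mul N = K.mul (L.mul N) := by
  ext ω
  constructor
  · rintro ⟨υ, ⟨σ, hσ, τ, hτ, h₁⟩, ρ, hρ, h₂⟩
    obtain ⟨φ, h₃, h₄⟩ := h₁.assoc h₂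
    exact ⟨σ, hσ, φ, ⟨τ, hτ, ρ, hρ, h₃⟩, h₄⟩
  · rintro ⟨σ, hσ, υ, ⟨τ, hτ, ρ, hρ, h₁⟩, h₂⟩
    obtain ⟨φ, h₃, h₄⟩ := h₁.assoc' h₂
    exact ⟨φ, ⟨σ, hσ, τ, hτ, h₃⟩, ρ, hρ, h₄⟩

theorem concatList_nil_left {x y : List (Elem P B)} : ConcatList [] x y ↔ x = y := by
  refine ⟨fun h => ?_, fun h => h ▸ .nil_left _⟩
  generalize hw : ([] : List (Elem P B)) = w at h
  cases h <;> simp_all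

theorem one_mul (L : MixedLang P B) : MixedLang.mul {epsString} L = L := by
  ext σ
  constructor
  · rintro ⟨_, rfl, τ, hτ, h⟩
    rwa [← Subtype.ext (concatList_nil_left.1 h)]
  · exact fun h => ⟨_, rfl, σ, h, ConcatList.nil_left _⟩

theorem mul_one (L : MixedLang P B) : MixedLang.mul L {epsString} = L := by
  ext σ
  constructor
  · rintro ⟨τ, hτ, _, rfl, h⟩
    have h := congrArg List.reverse (concatList_nil_left.1 (ConcatList.reverse h))
    simp only [List.reverse_reverse] at h
    rwa [← Subtype.ext h]
  · exact fun h => ⟨σ, h, _, rfl, ConcatList.nil_right _⟩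

theorem union_mul (K L N : MixedLang P B) : (K ∪ L : MixedLang P B).mul N = K.mul N ∪ L.mul N := by
  ext ω
  constructor
  · rintro ⟨σ, hσ | hσ, h⟩
    exacts [.inl ⟨σ, hσ, h⟩, .inr ⟨σ, hσ, h⟩]
  · rintro (⟨σ, hσ, h⟩ | ⟨σ, hσ, h⟩)
    exacts [⟨σ, .inl hσ, h⟩, ⟨σ, .inr hσ, h⟩]

theorem mul_union (K L N : MixedLang P B) : K.mul (L ∪ N) = K.mul L ∪ K.mul N := by
  ext ω
  constructor
  · rintro ⟨σ, hσ, τ, hτ | hτ, h⟩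
    exacts [.inl ⟨σ, hσ, τ, hτ, h⟩, .inr ⟨σ, hσ, τ, hτ, h⟩]
  · rintro (⟨σ, hσ, τ, hτ, h⟩ | ⟨σ, hσ, τ, hτ, h⟩)
    exacts [⟨σ, hσ, τ, .inl hτ, h⟩, ⟨σ, hσ, τ, .inr hτ, h⟩]

theorem iUnion_pow (L : MixedLang P B) :
    (⋃ n, L.pow n) = {epsString} ∪ L.mul (⋃ n, L.pow n) := by
  ext σ
  simp only [Set.mem_iUnion, Set.mem_union]
  constructor
  · rintro ⟨_ | n, h⟩
    · exact .inl h
    · obtain ⟨τ, hτ, ρ, hρ, h⟩ := h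
      exact .inr ⟨τ, hτ, ρ, Set.mem_iUnion.2 ⟨n, hρ⟩, h⟩
  · rintro (h | ⟨τ, hτ, ρ, hρ, h⟩)
    · exact ⟨0, h⟩
    · obtain ⟨n, hn⟩ := Set.mem_iUnion.1 hρ
      exact ⟨n + 1, τ, hτ, ρ, hn, h⟩

end MixedLang

theorem litString_comm_subset (l l' : Literal B) :
    MixedLang.mul {litString l} {litString l'} ⊆
      (MixedLang.mul {litString l'} {litString l} : MixedLang P B) := by
  rintro ρ ⟨_, rfl, _, rfl, h⟩
  refine ⟨_, rfl, _, rfl, ?_⟩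
  rcases concatList_singleton h with ⟨h, -⟩ | ⟨a, z, h, h', -⟩ | ⟨t, t', z, h₁, h₂, h₃, h₄⟩
  · simp [litString] at h
  · simp only [litString, List.cons.injEq] at h
    simp [← h.1, Elem.isTest] at h'
  · simp only [litString, List.cons.injEq, Elem.test.injEq] at h₁ h₂
    obtain ⟨rfl, rfl⟩ := h₂
    subst h₁
    have := ConcatList.merge (P := P) [] _ _ [] h₃.symm
    rwa [Finset.union_comm, ← h₄] at this

/-- Both products are empty if the bases coincide; otherwise they consist of the test `{l} ∪ {l'}`.
-/
theorem litString_comm (l l' : Literal B) :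
    MixedLang.mul {litString l} {litString l'} =
      (MixedLang.mul {litString l'} {litString l} : MixedLang P B) :=
  (litString_comm_subset l l').antisymm (litString_comm_subset l' l)

/-! ### Soundness of typing -/

theorem MixedString.hasType_iff_of_eq {σ : MixedString P B} {a a' : Elem P B}
    {x : List (Elem P B)} (h : σ.1 = a :: (x ++ [a'])) {A A' : Finset B} :
    σ.HasType A A' ↔ A = a.base ∧ A' = Finset.univ \ a'.base := by
  obtain ⟨_, hσ⟩ := σ
  subst h
  cases x <;> simp [MixedString.HasType]

theorem eq_sdiff_of_union_eq_univ {s t : Finset B} (h : Disjoint s t)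
    (hu : Finset.univ = t ∪ s) : s = Finset.univ \ t := by
  rw [hu, Finset.union_sdiff_left, Finset.sdiff_eq_self_of_disjoint h]

/-- The type of a string with at least two symbols depends only on its end symbols, so the work lies
in factors with a single symbol, whose types have another form. -/
theorem Concat.hasType {σ τ ρ : MixedString P B} (h : Concat σ τ ρ) {A A' A'' : Finset B}
    (hσ : σ.HasType A A') (hτ : τ.HasType A' A'') : ρ.HasType A A'' := by
  obtain ⟨x, hx⟩ := σ
  obtain ⟨y, hy⟩ := τ
  obtain ⟨z, hz⟩ := ρ
  simp only [Concat] at h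
  cases h with
  | nil_left => rwa [show A = A' from hσ]
  | nil_right => rwa [← show A' = A'' from hτ]
  | juxtapose x a a' y ha =>
    obtain ⟨e, m, hm, h₁⟩ : ∃ e m, x ++ [a] = e :: m ∧ A = e.base := by
      cases x with
      | cons e x => exact ⟨e, _, rfl, ((MixedString.hasType_iff_of_eq rfl).1 hσ).1⟩
      | nil =>
        refine ⟨a, [], rfl, ?_⟩
        cases a with
        | prog => exact hσ.1
        | test t =>
          cases a' with
          | test => simp [Elem.isTest] at ha
          | prog =>
            -- `σ` is a lone test, of type `testBase t ∪ A' → A'`; as `τ` starts with a program,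
            -- `A'` is empty.
            obtain rfl : A' = ∅ := by cases y <;> exact hτ.1
            exact hσ.2.trans (Finset.union_empty _)
    obtain ⟨m', f, hm', h₂⟩ : ∃ m' f, a' :: y = m' ++ [f] ∧ A'' = Finset.univ \ f.base := by
      rcases List.eq_nil_or_concat' y with rfl | ⟨y, f, rfl⟩
      · refine ⟨[], a', rfl, ?_⟩
        cases a' with
        | prog => exact hτ.2.trans (by simp [Elem.base])
        | test t =>
          cases a with
          | test => simp [Elem.isTest] at ha
          | prog =>
            -- Dually, `τ` is a lone test and `σ` ends in a program.
            obtain rfl : A' = Finset.univ := by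
              cases x with
              | nil => exact hσ.2
              | cons e x =>
                exact ((MixedString.hasType_iff_of_eq rfl).1 hσ).2.trans (by simp [Elem.base])
            exact eq_sdiff_of_union_eq_univ hτ.1 hτ.2
      · exact ⟨a' :: y, f, rfl, ((MixedString.hasType_iff_of_eq rfl).1 hτ).2⟩
    refine (MixedString.hasType_iff_of_eq (x := m ++ m') ?_).2 ⟨h₁, h₂⟩
    calc x ++ a :: a' :: y = (x ++ [a]) ++ (a' :: y) := by simp
      _ = _ := by simp [hm, hm']
  | merge x t t' y ht =>
    rcases x with _ | ⟨e, x⟩ <;> rcases List.eq_nil_or_concat' y with rfl | ⟨y, f, rfl⟩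
    · obtain ⟨h₁, rfl⟩ := hσ
      obtain ⟨h₂, rfl⟩ := hτ
      rw [Finset.disjoint_union_left] at h₁
      refine ⟨?_, ?_⟩
      · rw [testBase_union, Finset.disjoint_union_right]
        exact ⟨h₁.2, h₂⟩
      · rw [testBase_union, Finset.union_assoc]
    · obtain ⟨rfl, rfl⟩ := (MixedString.hasType_iff_of_eq rfl).1 hτ
      exact (MixedString.hasType_iff_of_eq rfl).2 ⟨hσ.2.trans (testBase_union _ _).symm, rfl⟩
    · obtain ⟨rfl, h₁⟩ := (MixedString.hasType_iff_of_eq rfl).1 hσ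
      obtain ⟨h₂, rfl⟩ := hτ
      refine (MixedString.hasType_iff_of_eq rfl).2 ⟨rfl, ?_⟩
      simp only [Elem.base] at h₁ ⊢
      rw [testBase_union]
      refine eq_sdiff_of_union_eq_univ ?_ ?_
      · refine Finset.disjoint_union_right.2 ⟨?_, h₂⟩
        exact Finset.disjoint_of_subset_left Finset.subset_union_right
          (h₁ ▸ Finset.sdiff_disjoint)
      · rw [Finset.union_assoc, h₁, Finset.union_sdiff_of_subset (Finset.subset_univ _)]
    · obtain ⟨rfl, -⟩ := (MixedString.hasType_iff_of_eq rfl).1 hσ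
      obtain ⟨-, rfl⟩ := (MixedString.hasType_iff_of_eq rfl).1 hτ
      exact (MixedString.hasType_iff_of_eq (x := x ++ .test (t ∪ t') :: y) (by simp)).2 ⟨rfl, rfl⟩

theorem MixedExpr.HasType.lang {e : MixedExpr P B} {A A' : Finset B} (h : e.HasType A A') :
    e.lang.HasType A A' := by
  induction h with
  | zero => exact fun _ h => h.elim
  | one => rintro _ rfl; rfl
  | prog => rintro _ rfl; exact ⟨rfl, rfl⟩
  | lit l A =>
    rintro _ rfl
    refine ⟨?_, ?_⟩
    · simp [testBase_singleton]
    · simp [testBase_singleton, Finset.union_comm]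
  | add _ _ h₁ h₂ => exact fun σ h => h.elim (h₁ σ) (h₂ σ)
  | mul _ _ h₁ h₂ => rintro σ ⟨τ, hτ, ρ, hρ, h⟩; exact h.hasType (h₁ _ hτ) (h₂ _ hρ)
  | star _ ih =>
    intro σ hσ
    obtain ⟨n, hn⟩ := Set.mem_iUnion.1 hσ
    clear hσ
    induction n generalizing σ with
    | zero => obtain rfl := hn; rfl
    | succ n ih' =>
      obtain ⟨τ, hτ, ρ, hρ, h⟩ := hn
      exact h.hasType (ih _ hτ) (ih' _ hρ)

/-! ### Reading the first symbol of a string -/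

theorem concat_progString_iff {p : P} {σ ρ : MixedString P B} :
    Concat (progString p) σ ρ ↔ ρ.1 = .prog p :: σ.1 := by
  obtain ⟨x, hx⟩ := σ
  obtain ⟨y, hy⟩ := ρ
  constructor
  · intro h
    rcases concatList_singleton h with ⟨h₁, h₂⟩ | ⟨a, z, h₁, -, h₂⟩ | ⟨t, t', z, h₁, -⟩
    · simp_all
    · simp_all
    · simp at h₁
  · rintro rfl
    cases x with
    | nil => exact .nil_right _
    | cons a x =>
      exact .juxtapose [] _ _ _ (List.isChain_cons_cons.1 hy.alternating).1

theorem concat_litString {l : Literal B} {σ ρ : MixedString P B} (h : Concat (litString l) σ ρ) :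
    ∃ t x, ρ.1 = .test t :: x ∧ l ∈ t ∧
      σ.1 = if t = {l} then x else .test (t.erase l) :: x := by
  obtain ⟨x, hx⟩ := σ
  obtain ⟨y, hy⟩ := ρ
  rcases concatList_singleton h with ⟨h₁, h₂⟩ | ⟨a, z, h₁, -, h₂⟩ | ⟨t, t', z, h₁, h₂, h₃, h₄⟩
  · exact ⟨{l}, x, by simp_all, by simp, by simp⟩
  · exact ⟨{l}, x, by simp_all, by simp, by simp⟩
  · simp only [Elem.test.injEq] at h₁ h₂ h₄
    subst h₁ h₂ h₄
    have hl : l ∉ t' := fun hl => by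
      rw [testBase_singleton, Finset.disjoint_singleton_left] at h₃
      exact h₃ (Finset.mem_image_of_mem _ hl)
    refine ⟨_, z, rfl, by simp, ?_⟩
    rw [if_neg]
    · simp [Finset.erase_eq_of_notMem hl]
    · intro h
      obtain ⟨k, hk⟩ := (hx.tests t' (by simp)).1
      have hk' : k ∈ ({l} : Finset (Literal B)) := h ▸ Finset.mem_union_right _ hk
      exact hl (Finset.mem_singleton.1 hk' ▸ hk)

theorem exists_concat_litString {l : Literal B} {t : Finset (Literal B)} {x : List (Elem P B)}
    {ρ : MixedString P B} (h : ρ.1 = .test t :: x) (hl : l ∈ t) :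
    ∃ σ, Concat (litString l) σ ρ := by
  obtain ⟨y, hy⟩ := ρ
  subst h
  by_cases ht : t = {l}
  · subst ht
    refine ⟨⟨x, hy.tail⟩, ?_⟩
    cases x with
    | nil => exact .nil_right _
    | cons a x =>
      exact .juxtapose [] _ _ _ (List.isChain_cons_cons.1 hy.alternating).1
  · have hn : (t.erase l).Nonempty := by
      rw [Finset.nonempty_iff_ne_empty, Ne, Finset.erase_eq_empty_iff]
      rintro (rfl | h)
      exacts [Finset.notMem_empty _ hl, ht h]
    have htest := hy.tests t (by simp)
    refine ⟨⟨_, isMixedWord_replace hy (htest.mono hn (Finset.erase_subset _ _))⟩, ?_⟩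
    have hd : Disjoint (testBase {l}) (testBase (t.erase l)) := by
      rw [testBase_singleton, Finset.disjoint_singleton_left, testBase, Finset.mem_image]
      rintro ⟨k, hk, hkl⟩
      rw [Finset.mem_erase] at hk
      exact hk.1 (htest.2 hk.2 hl hkl)
    have := ConcatList.merge (P := P) [] _ _ x hd
    rwa [← Finset.insert_eq, Finset.insert_erase hl] at this

theorem isMixedWord_cons {a b : Elem P B} {x : List (Elem P B)} (h : IsMixedWord (b :: x))
    (ha : ∀ t, a = .test t → IsTest t) (hab : a.isTest ≠ b.isTest)
    (hb : ∀ t, b = .test t → x ≠ [] → testBase t = Finset.univ) : IsMixedWord (a :: b :: x) where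
  tests t ht := by
    rcases List.mem_cons.1 ht with ht | ht
    · exact ha t ht.symm
    · exact h.tests t ht
  alternating := List.isChain_cons_cons.2 ⟨hab, h.alternating⟩
  complete y z t e hy hz := by
    rcases y with _ | ⟨c, _ | ⟨d, y⟩⟩
    · exact absurd rfl hy
    · simp only [List.cons_append, List.nil_append, List.cons.injEq] at e
      exact hb t e.2.1 (e.2.2 ▸ hz)
    · simp only [List.cons_append, List.cons.injEq] at e
      exact h.complete (d :: y) z t (by simp [e.2.1, e.2.2]) (by simp) hz

/-- If `σ` starts with a test, the base of that test is `A`, so `l` can be merged into it. -/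
theorem exists_litString_concat {l : Literal B} {A : Finset B} {σ : MixedString P B}
    (hσ : σ.HasType A ∅) (hl : l.base ∉ A) : ∃ ρ, Concat (litString l) σ ρ := by
  have hlt : IsTest ({l} : Finset (Literal B)) := (litString (P := P) l).2.tests _
    (by simp [litString])
  obtain ⟨x, hx⟩ := σ
  rcases x with _ | ⟨p | t, x⟩
  · exact ⟨litString l, .nil_right _⟩
  · exact ⟨⟨_, isMixedWord_cons hx (a := .test {l}) (by simpa using hlt)
      (by simp [Elem.isTest]) (by simp)⟩,
      .juxtapose [] _ _ _ (by simp [Elem.isTest])⟩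
  · have hA : A = testBase t := by
      cases x with
      | nil => exact hσ.2.trans (Finset.union_empty _)
      | cons => exact hσ.1
    subst hA
    exact ⟨⟨_, isMixedWord_replace hx (isTest_insert (hx.tests t (by simp)) hl)⟩,
      .merge [] _ _ _ (by rwa [testBase_singleton, Finset.disjoint_singleton_left])⟩

/-- Behind `p` the first test of `σ` may become an inner one; the type makes it complete. Without
primitive tests `Finset.univ` would be empty and `σ` could start with a program. -/
theorem exists_progString_concat [Nonempty B] (p : P) {σ : MixedString P B}
    (hσ : σ.HasType Finset.univ ∅) : ∃ ρ, Concat (progString p) σ ρ := by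
  obtain ⟨x, hx⟩ := σ
  rcases x with _ | ⟨p' | t, x⟩
  · exact ⟨progString p, .nil_right _⟩
  · have : (Finset.univ : Finset B) = ∅ := by cases x <;> exact hσ.1
    exact absurd this Finset.univ_nonempty.ne_empty
  · refine ⟨⟨_, isMixedWord_cons hx (a := .prog p) (by simp) (by simp [Elem.isTest]) ?_⟩,
      .juxtapose [] _ _ _ (by simp [Elem.isTest])⟩
    rintro _ ⟨⟩ hne
    obtain ⟨c, x, rfl⟩ := List.exists_cons_of_ne_nil hne
    exact hσ.1.symm

theorem derivProg_mul (p p' : P) [DecidableEq P] [Nonempty B] {L : MixedLang P B}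
    (hL : L.HasType Finset.univ ∅) :
    derivProg p (MixedLang.mul {progString p'} L) = if p = p' then L else ∅ := by
  ext σ
  constructor
  · rintro ⟨ρ, ⟨_, rfl, τ, hτ, h₁⟩, h₂⟩
    rw [concat_progString_iff] at h₁ h₂
    obtain ⟨h, h'⟩ := List.cons.inj (h₂.symm.trans h₁)
    rw [if_pos (Elem.prog.inj h)]
    rwa [Subtype.ext h']
  · split_ifs with h
    · subst h
      intro hσ
      obtain ⟨ρ, hρ⟩ := exists_progString_concat p (hL σ hσ)
      exact ⟨ρ, ⟨_, rfl, σ, hσ, hρ⟩, hρ⟩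
    · exact fun h => h.elim

/-- Prefixing by `l` is injective, and by typing always defined on `L`. The second summand
contributes nothing: a test cannot contain both `l` and `l'`. -/
theorem derivLit_mul {l l' : Literal B} (h : l'.base = l.base) (hne : l' ≠ l) {A : Finset B}
    (hl : l.base ∉ A) {L L' : MixedLang P B} (hL : L.HasType A ∅) :
    derivLit l (MixedLang.mul {litString l} L ∪ MixedLang.mul {litString l'} L') = L := by
  ext σ
  constructor
  · rintro ⟨ρ, ⟨_, rfl, τ, hτ, h₁⟩ | ⟨_, rfl, τ, hτ, h₁⟩, h₂⟩
    · obtain ⟨t, x, h₃, -, h₄⟩ := concat_litString h₁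
      obtain ⟨t', x', h₃', -, h₄'⟩ := concat_litString h₂
      obtain ⟨e, rfl⟩ := List.cons.inj (h₃.symm.trans h₃')
      obtain rfl := Elem.test.inj e
      rwa [Subtype.ext (h₄'.trans h₄.symm)]
    · obtain ⟨t, x, h₃, hlt, -⟩ := concat_litString h₁
      obtain ⟨t', x', h₃', hlt', -⟩ := concat_litString h₂
      obtain ⟨e, rfl⟩ := List.cons.inj (h₃.symm.trans h₃')
      obtain rfl := Elem.test.inj e
      exact absurd ((ρ.2.tests t (by simp [h₃])).2 hlt hlt' h) hne
  · intro hσ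
    obtain ⟨ρ, hρ⟩ := exists_litString_concat (hL σ hσ) hl
    exact ⟨ρ, .inl ⟨_, rfl, σ, hσ, hρ⟩, hρ⟩

theorem mem_derivProg {p : P} {L : MixedLang P B} {σ ρ : MixedString P B}
    (h : Concat (progString p) σ ρ) : σ ∈ derivProg p L ↔ ρ ∈ L := by
  refine ⟨?_, fun hρ => ⟨ρ, hρ, h⟩⟩
  rintro ⟨ρ', hρ', h'⟩
  rw [concat_progString_iff] at h h'
  rwa [Subtype.ext (h.trans h'.symm)]

/-- Concatenation is single-valued: `l` and `σ` determine `ρ`. -/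
theorem mem_derivLit {l : Literal B} {L : MixedLang P B} {σ ρ : MixedString P B}
    (h : Concat (litString l) σ ρ) : σ ∈ derivLit l L ↔ ρ ∈ L := by
  refine ⟨?_, fun hρ => ⟨ρ, hρ, h⟩⟩
  rintro ⟨ρ', hρ', h'⟩
  obtain ⟨x, hx⟩ := ρ
  obtain ⟨y, hy⟩ := ρ'
  suffices x = y by subst this; exact hρ'
  rcases concatList_singleton h with ⟨h₁, h₂⟩ | ⟨a, z, h₁, h₅, h₂⟩ | ⟨t, t', z, h₁, h₂, h₃, h₄⟩ <;>
  rcases concatList_singleton h' with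
    ⟨h₁', h₂'⟩ | ⟨a', z', h₁', h₅', h₂'⟩ | ⟨s, s', z', h₁', h₂', h₃', h₄'⟩ <;>
  grind [Elem.isTest]

/-! ### Coinduction -/

/-- The number of programs and literals in an element. -/
def Elem.size : Elem P B → ℕ
  | .prog _ => 1
  | .test t => t.card

/-- The number of programs and literals in a mixed string. -/
def MixedString.size (σ : MixedString P B) : ℕ :=
  (σ.1.map Elem.size).sum

theorem Concat.size_lt_of_progString {p : P} {σ ρ : MixedString P B}
    (h : Concat (progString p) σ ρ) : σ.size < ρ.size := by
  rw [concat_progString_iff] at h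
  simp [MixedString.size, h, Elem.size]

/-- Literals must be counted individually here: removing one from a larger test leaves the length of
the list unchanged. -/
theorem Concat.size_lt_of_litString {l : Literal B} {σ ρ : MixedString P B}
    (h : Concat (litString l) σ ρ) : σ.size < ρ.size := by
  obtain ⟨t, x, h₁, hl, h₂⟩ := concat_litString h
  rw [MixedString.size, MixedString.size, h₁, h₂]
  have := Finset.card_erase_lt_of_mem hl
  split_ifs with ht
  · subst ht
    simp [Elem.size]
  · simpa [Elem.size] using this

theorem MixedString.HasType.eq_or_concat_progString {σ : MixedString P B}
    (h : σ.HasType ∅ ∅) : σ = epsString ∨ ∃ p τ, Concat (progString p) τ σ := by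
  obtain ⟨x, hx⟩ := σ
  rcases x with _ | ⟨p | t, x⟩
  · exact .inl rfl
  · exact .inr ⟨p, ⟨x, hx.tail⟩, concat_progString_iff.2 rfl⟩
  · have ht : ∅ = testBase t := by
      cases x with
      | nil => exact h.2.trans (Finset.union_empty _)
      | cons => exact h.1
    exact absurd (Finset.image_eq_empty.1 ht.symm) (hx.tests t (by simp)).1.ne_empty

theorem MixedString.HasType.exists_concat_litString {σ : MixedString P B} {A : Finset B}
    (h : σ.HasType A ∅) {b : B} (hb : b ∈ A) :
    ∃ l τ, l.base = b ∧ Concat (litString l) τ σ := by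
  obtain ⟨x, hx⟩ := σ
  rcases x with _ | ⟨p | t, x⟩
  · simp [show A = ∅ from h] at hb
  · have : A = ∅ := by cases x <;> exact h.1
    simp [this] at hb
  · have ht : A = testBase t := by
      cases x with
      | nil => exact h.2.trans (Finset.union_empty _)
      | cons => exact h.1
    subst ht
    obtain ⟨l, hl, rfl⟩ := Finset.mem_image.1 hb
    obtain ⟨τ, hτ⟩ := MixedKAT.exists_concat_litString (ρ := ⟨_, hx⟩) rfl hl
    exact ⟨l, τ, rfl, hτ⟩

theorem mem_iff_of_pseudoBisimulation {bs : List B}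
    {R : ℕ → ∀ A : Finset B, (langAutomaton P B).State A → (langAutomaton P B).State A → Prop}
    (hR : IsPseudoBisimulation bs (langAutomaton P B) (langAutomaton P B) R)
    (σ : MixedString P B) {i : ℕ} {A : Finset B} {K L : (langAutomaton P B).State A}
    (h : R i A K L) : σ ∈ K.1 ↔ σ ∈ L.1 := by
  induction hn : σ.size using Nat.strong_induction_on generalizing σ i A with
  | _ n ih =>
    subst hn
    -- Strings of another type lie in neither language.
    by_cases hσ : σ.HasType A ∅
    swap
    · exact ⟨fun hK => absurd (K.2 σ hK) hσ, fun hL => absurd (L.2 σ hL) hσ⟩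
    obtain ⟨hi, rfl⟩ := hR.support i A K L h
    cases i with
    | zero =>
      rcases hσ.eq_or_concat_progString with rfl | ⟨p, τ, hc⟩
      · simpa [langAutomaton] using hR.out_eq K L h
      · have := ih _ hc.size_lt_of_progString τ (hR.prog K L h p) rfl
        rwa [← mem_derivProg hc, ← mem_derivProg hc]
    | succ i =>
      have hb : bs[i] ∈ initialSet bs (i + 1) := by
        rw [initialSet, List.mem_toFinset]
        exact List.mem_take_iff_getElem.2 ⟨i, by simp; omega, rfl⟩
      obtain ⟨l, τ, hl, hc⟩ := hσ.exists_concat_litString hb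
      have := ih _ hc.size_lt_of_litString τ (hR.lit i hi K L h l (hl ▸ hb) hl) rfl
      rwa [← mem_derivLit hc, ← mem_derivLit hc]

theorem eq_of_pseudoBisimulation {bs : List B}
    {R : ℕ → ∀ A : Finset B, (langAutomaton P B).State A → (langAutomaton P B).State A → Prop}
    (hR : IsPseudoBisimulation bs (langAutomaton P B) (langAutomaton P B) R)
    {i : ℕ} {A : Finset B} {K L : (langAutomaton P B).State A}
    (h : R i A K L) : K.1 = L.1 :=
  Set.ext fun σ => mem_iff_of_pseudoBisimulation hR σ h

end General
end MixedKAT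
namespace MixedKAT
namespace Ex

/-! ### Typing derivations for the listed expressions. -/

theorem hasType_of {e : MixedExpr Prog Tst} {A A' C C' : Finset Tst} (h : e.HasType A A')
    (hA : A = C) (hA' : A' = C') : e.HasType C C' := hA ▸ hA' ▸ h

theorem p_hasType : p.HasType ∅ {.b, .c} := .prog _
theorem q_hasType : q.HasType ∅ {.b, .c} := .prog _
theorem b_hasType : b.HasType {.b} ∅ := .lit _ ∅
theorem nb_hasType : nb.HasType {.b} ∅ := .lit _ ∅
theorem c_hasType : c.HasType {.c} ∅ := .lit _ ∅
theorem nc_hasType : nc.HasType {.c} ∅ := .lit _ ∅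
theorem b_hasType' : b.HasType {.b, .c} {.c} := hasType_of (.lit _ {.c}) (by decide) (by decide)
theorem nb_hasType' : nb.HasType {.b, .c} {.c} := hasType_of (.lit _ {.c}) (by decide) (by decide)
theorem nc_hasType' : nc.HasType {.b, .c} {.b} := hasType_of (.lit _ {.b}) (by decide) (by decide)
theorem bb_hasType : bb.HasType {.b} ∅ := .add b_hasType nb_hasType
theorem bb_hasType' : bb.HasType {.b, .c} {.c} := .add b_hasType' nb_hasType'

theorem bb_c_q_hasType : (bb * c * q).HasType {.b, .c} {.b, .c} :=
  .mul (.mul bb_hasType' c_hasType) q_hasType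

theorem loop_hasType : (bb * c * q + b * nc * p).HasType {.b, .c} {.b, .c} :=
  .add bb_c_q_hasType (.mul (.mul b_hasType' nc_hasType) p_hasType)

theorem α_hasType : α.HasType {.b} ∅ :=
  .mul (.star (.mul (.mul (.mul b_hasType p_hasType) (.star bb_c_q_hasType)) nc_hasType')) nb_hasType

theorem β_hasType : β.HasType {.b} ∅ :=
  .add (.mul (.mul (.mul (.mul b_hasType p_hasType) (.star loop_hasType)) nc_hasType') nb_hasType)
    nb_hasType

theorem α'_hasType : α'.HasType {.b, .c} ∅ := .mul (.mul (.star bb_c_q_hasType) nc_hasType') α_hasType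
theorem β'_hasType : β'.HasType {.b, .c} ∅ := .mul (.mul (.star loop_hasType) nc_hasType') nb_hasType

theorem hasType_of_mem_pairs {i : ℕ} {e e' : MixedExpr Prog Tst} (h : (e, e') ∈ pairs i) :
    e.HasType (initialSet order i) ∅ ∧ e'.HasType (initialSet order i) ∅ := by
  rcases i with _ | _ | _ | i
  · rcases h with h | h | h | h <;> obtain ⟨rfl, rfl⟩ := Prod.mk.inj h
    · exact ⟨.mul p_hasType α'_hasType, .mul p_hasType β'_hasType⟩
    · exact ⟨.mul q_hasType α'_hasType, .mul q_hasType β'_hasType⟩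
    · exact ⟨.one _, .one _⟩
    · exact ⟨.zero _ _, .zero _ _⟩
  · rcases h with h | h | h <;> obtain ⟨rfl, rfl⟩ := Prod.mk.inj h
    · exact ⟨.mul (.mul bb_hasType q_hasType) α'_hasType,
        .mul (.mul bb_hasType q_hasType) β'_hasType⟩
    · exact ⟨α_hasType, β_hasType⟩
    · exact ⟨.zero _ _, .zero _ _⟩
  · rcases h with h | h <;> obtain ⟨rfl, rfl⟩ := Prod.mk.inj h
    · exact ⟨α'_hasType, β'_hasType⟩
    · exact ⟨.zero _ _, .zero _ _⟩
  · exact h.elim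

/-! ### Splitting the languages by their first symbol -/

theorem lang_one : (1 : MixedExpr Prog Tst).lang = {epsString} := rfl
theorem lang_add (e e' : MixedExpr Prog Tst) : (e + e').lang = e.lang ∪ e'.lang := rfl
theorem lang_mul (e e' : MixedExpr Prog Tst) : (e * e').lang = e.lang.mul e'.lang := rfl

theorem lang_star (e : MixedExpr Prog Tst) :
    e.star.lang = {epsString} ∪ e.lang.mul e.star.lang :=
  MixedLang.iUnion_pow _

theorem b_mul_c : b.lang.mul c.lang = c.lang.mul b.lang := litString_comm _ _
theorem b_mul_nc : b.lang.mul nc.lang = nc.lang.mul b.lang := litString_comm _ _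
theorem nb_mul_c : nb.lang.mul c.lang = c.lang.mul nb.lang := litString_comm _ _

theorem bb_mul_c : bb.lang.mul c.lang = c.lang.mul bb.lang := by
  simp only [bb, lang_add, MixedLang.union_mul, MixedLang.mul_union, b_mul_c, nb_mul_c]

/-- One unfolding of the outer star; what follows `b p` is then `α'`. -/
theorem α_lang : α.lang = b.lang.mul (p * α').lang ∪ nb.lang.mul (1 : MixedExpr Prog Tst).lang := by
  rw [α, lang_mul, lang_star, MixedLang.union_mul, MixedLang.one_mul, lang_one, MixedLang.mul_one,
    Set.union_comm]
  simp only [lang_mul, MixedLang.mul_assoc, α', α]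

theorem β_lang : β.lang = b.lang.mul (p * β').lang ∪ nb.lang.mul (1 : MixedExpr Prog Tst).lang := by
  rw [β, lang_add, lang_one, MixedLang.mul_one]
  simp only [lang_mul, MixedLang.mul_assoc, β']

theorem bb_mul_lang (e : MixedExpr Prog Tst) :
    (bb * q * e).lang = b.lang.mul (q * e).lang ∪ nb.lang.mul (q * e).lang := by
  simp only [bb, lang_mul, lang_add, MixedLang.mul_assoc, MixedLang.union_mul]

/-- After one unfolding of the star, `c` is moved in front of `[b]`. -/
theorem α'_lang : α'.lang = c.lang.mul (bb * q * α').lang ∪ nc.lang.mul α.lang := by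
  rw [α', lang_mul, lang_mul, lang_star, MixedLang.union_mul, MixedLang.union_mul,
    MixedLang.one_mul, Set.union_comm]
  simp only [lang_mul, bb_mul_c, MixedLang.mul_assoc]

/-- Unfolding gives `[b]cqβ' + bc̄pβ' + c̄b̄`. With `c̄` moved to the front, the last two summands
combine to `c̄(bpβ' + b̄) = c̄β`. -/
theorem β'_lang : β'.lang = c.lang.mul (bb * q * β').lang ∪ nc.lang.mul β.lang := by
  rw [β_lang, lang_one, MixedLang.mul_one, β', lang_mul, lang_mul, lang_star,
    MixedLang.union_mul, MixedLang.union_mul, MixedLang.one_mul]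
  simp only [lang_mul, lang_add, bb_mul_c, b_mul_nc, MixedLang.mul_assoc, MixedLang.union_mul,
    MixedLang.mul_union]
  ac_rfl

/-! ### The relations form a pseudo-bisimulation. -/

instance : DecidableEq Prog := fun
  | .p, .p => .isTrue rfl
  | .p, .q => .isFalse nofun
  | .q, .p => .isFalse nofun
  | .q, .q => .isTrue rfl

instance : Nonempty Tst := ⟨.b⟩

theorem epsString_notMem_prog_mul (r : Prog) (L : MixedLang Prog Tst) :
    epsString ∉ MixedLang.mul {progString r} L := by
  rintro ⟨_, rfl, τ, -, h⟩
  rw [concat_progString_iff] at h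
  simp [epsString] at h

theorem derivProg_eq_empty {L : MixedLang Prog Tst} (h : ∀ σ ∈ L, σ = epsString) (r : Prog) :
    derivProg r L = ∅ := by
  refine Set.eq_empty_of_forall_notMem ?_
  rintro σ ⟨ρ, hρ, hc⟩
  obtain rfl := h ρ hρ
  rw [concat_progString_iff] at hc
  simp [epsString] at hc

theorem derivLit_empty (l : Literal Tst) : derivLit l (∅ : MixedLang Prog Tst) = ∅ :=
  Set.eq_empty_of_forall_notMem fun _ ⟨_, h, _⟩ => h

/-- Both literals with base `x` take the union of `x·e₁` and `x̄·e₂` to `e₁` and `e₂`. -/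
theorem derivLit_split {x : Tst} {A : Finset Tst} (hx : x ∉ A) {K L : MixedLang Prog Tst}
    (hK : K.HasType A ∅) (hL : L.HasType A ∅) {l : Literal Tst} (hl : l.base = x) :
    derivLit l (MixedLang.mul {litString (.pos x)} K ∪ MixedLang.mul {litString (.neg x)} L) =
      match l with
      | .pos _ => K
      | .neg _ => L := by
  cases l <;> obtain rfl := hl
  · exact derivLit_mul (l := .pos _) (l' := .neg _) rfl (by simp) hx hK
  · rw [Set.union_comm]
    exact derivLit_mul (l := .neg _) (l' := .pos _) rfl (by simp) hx hL

theorem isPseudoBisimulation :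
    IsPseudoBisimulation order (langAutomaton Prog Tst) (langAutomaton Prog Tst) R where
  nodup := by decide
  exhaustive x := by cases x <;> decide
  support i A K L h := by
    obtain ⟨rfl, e, e', he, -⟩ := h
    refine ⟨?_, rfl⟩
    rcases i with _ | _ | _ | i
    · decide
    · decide
    · decide
    · exact he.elim
  out_eq := by
    rintro ⟨K, hK⟩ ⟨L, hL⟩ ⟨-, e, e', h, rfl, rfl⟩
    refine decide_eq_decide.2 ?_
    rcases h with h | h | h | h <;> obtain ⟨rfl, rfl⟩ := Prod.mk.inj h
    · exact iff_of_false (epsString_notMem_prog_mul _ _) (epsString_notMem_prog_mul _ _)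
    · exact iff_of_false (epsString_notMem_prog_mul _ _) (epsString_notMem_prog_mul _ _)
    · rfl
    · rfl
  prog := by
    rintro ⟨K, hK⟩ ⟨L, hL⟩ ⟨-, e, e', h, rfl, rfl⟩ r
    refine ⟨by decide, ?_⟩
    change ∃ f f', (f, f') ∈ pairs 2 ∧ derivProg r e.lang = f.lang ∧ derivProg r e'.lang = f'.lang
    -- Reading `r` from `r'α'` and `r'β'` leads to `α'` and `β'` if `r = r'`, and to `0` on both
    -- sides otherwise.
    have key (r' : Prog) : ∃ f f', (f, f') ∈ pairs 2 ∧
        derivProg r (MixedLang.mul {progString r'} α'.lang) = f.lang ∧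
        derivProg r (MixedLang.mul {progString r'} β'.lang) = f'.lang := by
      rw [derivProg_mul _ _ α'_hasType.lang, derivProg_mul _ _ β'_hasType.lang]
      split_ifs
      · exact ⟨_, _, .inl rfl, rfl, rfl⟩
      · exact ⟨_, _, .inr rfl, rfl, rfl⟩
    rcases h with h | h | h | h <;> obtain ⟨rfl, rfl⟩ := Prod.mk.inj h
    · exact key .p
    · exact key .q
    · exact ⟨_, _, .inr rfl, derivProg_eq_empty (fun _ h => h) _,
        derivProg_eq_empty (fun _ h => h) _⟩
    · exact ⟨_, _, .inr rfl, derivProg_eq_empty (fun _ h => h.elim) _,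
        derivProg_eq_empty (fun _ h => h.elim) _⟩
  lit := by
    rintro i hi ⟨K, hK⟩ ⟨L, hL⟩ ⟨-, e, e', h, rfl, rfl⟩ l - hl
    have hi' : i = 0 ∨ i = 1 := by simp [order] at hi; omega
    change _ ∧ ∃ f f', (f, f') ∈ pairs i ∧ derivLit l e.lang = f.lang ∧ derivLit l e'.lang = f'.lang
    have hb : Tst.b ∉ (∅ : Finset Tst) := by decide
    have hc : Tst.c ∉ ({.b} : Finset Tst) := by decide
    -- The index is shifted by one: `i = 0` reads `b` from `R₁`, and `i = 1` reads `c` from `R₂`.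
    rcases hi' with rfl | rfl
    · change l.base = .b at hl
      refine ⟨by rw [hl]; decide, ?_⟩
      have one := (MixedExpr.HasType.one (P := Prog) (B := Tst) ∅).lang
      have pα := (p_hasType.mul α'_hasType).lang
      have pβ := (p_hasType.mul β'_hasType).lang
      have qα := (q_hasType.mul α'_hasType).lang
      have qβ := (q_hasType.mul β'_hasType).lang
      rcases h with h | h | h <;> obtain ⟨rfl, rfl⟩ := Prod.mk.inj h
      · rw [bb_mul_lang, bb_mul_lang]
        -- Under `[b]`, both literals over `b` lead to the same pair.
        refine ⟨_, _, .inr (.inl rfl), (derivLit_split hb qα qα hl).trans ?_,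
          (derivLit_split hb qβ qβ hl).trans ?_⟩ <;> cases l <;> rfl
      · rw [α_lang, β_lang]
        have h₁ := derivLit_split hb pα one hl
        have h₂ := derivLit_split hb pβ one hl
        cases l
        · exact ⟨_, _, .inl rfl, h₁, h₂⟩
        · exact ⟨_, _, .inr (.inr (.inl rfl)), h₁, h₂⟩
      · exact ⟨_, _, .inr (.inr (.inr rfl)), derivLit_empty _, derivLit_empty _⟩
    · change l.base = .c at hl
      refine ⟨by rw [hl]; decide, ?_⟩
      have bα := ((bb_hasType.mul q_hasType).mul α'_hasType).lang
      have bβ := ((bb_hasType.mul q_hasType).mul β'_hasType).lang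
      rcases h with h | h <;> obtain ⟨rfl, rfl⟩ := Prod.mk.inj h
      · rw [α'_lang, β'_lang]
        have h₁ := derivLit_split hc bα α_hasType.lang hl
        have h₂ := derivLit_split hc bβ β_hasType.lang hl
        cases l
        · exact ⟨_, _, .inl rfl, h₁, h₂⟩
        · exact ⟨_, _, .inr (.inl rfl), h₁, h₂⟩
      · exact ⟨_, _, .inr (.inr rfl), derivLit_empty _, derivLit_empty _⟩

end Ex
end MixedKAT

theorem mainTheorem7 :
    (∀ i ≤ 2, ∀ e e', (e, e') ∈ MixedKAT.Ex.pairs i →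
      e.HasType (MixedKAT.initialSet MixedKAT.Ex.order i) ∅ ∧
      e'.HasType (MixedKAT.initialSet MixedKAT.Ex.order i) ∅ ∧
      e.lang.HasType (MixedKAT.initialSet MixedKAT.Ex.order i) ∅ ∧
      e'.lang.HasType (MixedKAT.initialSet MixedKAT.Ex.order i) ∅) ∧
    MixedKAT.IsPseudoBisimulation MixedKAT.Ex.order
      (MixedKAT.langAutomaton MixedKAT.Prog MixedKAT.Tst)
      (MixedKAT.langAutomaton MixedKAT.Prog MixedKAT.Tst) MixedKAT.Ex.R ∧
    (∃ K L : (MixedKAT.langAutomaton MixedKAT.Prog MixedKAT.Tst).State {MixedKAT.Tst.b},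
      K.1 = MixedKAT.Ex.α.lang ∧ L.1 = MixedKAT.Ex.β.lang ∧
        MixedKAT.Ex.R 1 {MixedKAT.Tst.b} K L) ∧
    MixedKAT.Ex.α.lang = MixedKAT.Ex.β.lang := by
  have h : MixedKAT.Ex.R 1 {MixedKAT.Tst.b} ⟨_, MixedKAT.Ex.α_hasType.lang⟩
      ⟨_, MixedKAT.Ex.β_hasType.lang⟩ :=
    ⟨rfl, _, _, .inr (.inl rfl), rfl, rfl⟩
  refine ⟨fun i _ e e' he => ?_, MixedKAT.Ex.isPseudoBisimulation, ⟨_, _, rfl, rfl, h⟩,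
    MixedKAT.eq_of_pseudoBisimulation MixedKAT.Ex.isPseudoBisimulation h⟩
  obtain ⟨h₁, h₂⟩ := MixedKAT.Ex.hasType_of_mem_pairs he
  exact ⟨h₁, h₂, h₁.lang, h₂.lang⟩
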